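/- A distribution $p$ on $\{-1,1\}^n$ is a $k$-junta distribution if its probability mass function depends on at most $k$ of the $n$ variables. A general conditional query to $p$ is specified by an arbitrary nonempty set $A\subseteq\{-1,1\}^n$, and the oracle returns a fresh sample $x\sim p$ conditioned on $x\in A$; if $p(A)=0$, the oracle may reply by any fixed convention (for instance with a uniform point of $A$, or with a failure symbol). There are absolute constants $c_1,c_2>0$ such that the following holds for all $n\in\mathbb{N}$, all integers $0<k\le n-1$ and all $0<\varepsilon\le 1/120$. Suppose that a randomized, adaptive algorithm makes at most $q$ general conditional queries to an unknown distribution $p$ on $\{-1,1\}^n$ and outputs a distribution $\hat p$ on $\{-1,1\}^n$, and that for every $k$-junta distribution $p$, with probability at least $4/5$ over the randomness of the algorithm and of the oracle, $d_{\mathrm{TV}}(p,\hat p)=\frac12\sum_x|p(x)-\hat p(x)|\le\varepsilon$. Then $$q\;\ge\; c_1\,\frac{\log_2\binom{n}{k}}{\varepsilon^2}+c_2\,\frac{2^k}{\varepsilon^2}.$$ -/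

import Mathlib

open scoped ENNReal
open MeasureTheory

/-- The hypercube `{-1,1}^n`; the units of `ℤ` are exactly `1` and `-1`. -/
abbrev Cube (n : ℕ) : Type := Fin n → ℤˣ

/-- A distribution on `{-1,1}^n` is a `k`-junta distribution if its probability mass function
depends on at most `k` of the variables. -/
def IsJuntaDist {n : ℕ} (k : ℕ) (p : PMF (Cube n)) : Prop :=
  ∃ J : Finset (Fin n), J.card ≤ k ∧ DependsOn (fun x => p x) (J : Set (Fin n))

/-- Total variation distance between two distributions on `{-1,1}^n`. -/
noncomputable def dTV {n : ℕ} (p q : PMF (Cube n)) : ℝ :=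
  (1 / 2) * ∑ x : Cube n, |(p x).toReal - (q x).toReal|

/-- What an oracle may do when asked to condition on an event of probability zero: `Z p A` is the
distribution of the reply when `A` has probability zero under `p`. The reply may be a point of the
cube (say, a uniform point of `A`) or a failure symbol `none`. -/
abbrev ZeroRule (n : ℕ) : Type := PMF (Cube n) → Finset (Cube n) → PMF (Option (Cube n))

open Classical in
/-- The general conditional sampling oracle for `p`: on a query `A` it returns a sample from `p`
conditioned on `A`; if `A` has probability zero under `p`, it replies according to `Z`. -/
noncomputable def condOracle {n : ℕ} (Z : ZeroRule n) (p : PMF (Cube n)) (A : Finset (Cube n)) :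
    PMF (Option (Cube n)) :=
  if h : ∃ x ∈ (A : Set (Cube n)), x ∈ p.support then
    (p.filter (A : Set (Cube n)) h).map some
  else
    Z p A

/-- A deterministic adaptive algorithm with general conditional queries, as a decision tree.
It either stops with a hypothesis distribution, or queries an arbitrary nonempty set `A` and
continues in a way that depends on the reply. -/
inductive QueryTree (n : ℕ) : Type
  | output (hyp : PMF (Cube n)) : QueryTree n
  | query (A : Finset (Cube n)) (hA : A.Nonempty) (next : Option (Cube n) → QueryTree n) :
      QueryTree n

namespace QueryTree

/-- The worst-case number of queries. -/
def depth {n : ℕ} : QueryTree n → ℕ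
  | output _ => 0
  | query _ _ next => 1 + Finset.univ.sup fun r => (next r).depth

/-- The distribution of the hypothesis that is returned when each query `A` is answered by a fresh
draw from `O A`. -/
noncomputable def run {n : ℕ} (O : Finset (Cube n) → PMF (Option (Cube n))) :
    QueryTree n → PMF (PMF (Cube n))
  | output hyp => PMF.pure hyp
  | query A _ next => (O A).bind fun r => (next r).run O

/-- The probability that the algorithm, when run on `p`, returns a hypothesis within total
variation distance `ε` of `p`. -/
noncomputable def successProb {n : ℕ} (Z : ZeroRule n) (ε : ℝ) (p : PMF (Cube n))
    (T : QueryTree n) : ℝ≥0∞ :=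
  (T.run (condOracle Z p)).toOuterMeasure {hyp | dTV p hyp ≤ ε}

end QueryTree

/-- A randomized algorithm is a random decision tree `alg ω`, where `ω` (the internal randomness)
is drawn from the probability measure `P`. It learns `k`-junta distributions to within `ε` if for
every `k`-junta distribution `p` its hypothesis is `ε`-close to `p` with probability at least `4/5`,
over both its internal randomness and the replies of the oracle. -/
def LearnsJuntas {n : ℕ} {Ω : Type*} [MeasurableSpace Ω] (P : Measure Ω) (Z : ZeroRule n)
    (k : ℕ) (ε : ℝ) (alg : Ω → QueryTree n) : Prop :=
  ∀ p : PMF (Cube n), IsJuntaDist k p → 4 / 5 ≤ ∫⁻ ω, (alg ω).successProb Z ε p ∂P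

/-! Hide a balanced sign pattern `s` in the density `(1 + δ s) / 2^n`, with `δ = 60ε ≤ 1/2`.
Conditioning on any set keeps the reply within chi-square divergence `4δ²` of the reply for the
uniform distribution (`sq_sum_condOracle_tilt_le`). This multiplies along an adaptive tree
(`QueryTree.sq_run_le`): an event of probability `a` under the tilt and `b` under uniform satisfies
`a² ≤ (1 + 4δ²)^q b`. Under uniform, the success events of `N` tilts have total probability at most
`L` if no hypothesis serves more than `L` of them, so averaging gives `16 N ≤ 25 (1 + 4δ²)^q L`
(`card_le_of_learnsJuntas`). Parities on `k`-sets (`N = n.choose k`, `L = 1`) give the binomial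
term. Patterns `x i * t (k - 1 other coordinates)`, with `N = 2^(2^(k-1))` and `L` bounding a
Hamming ball, give the `2^k` term. -/

lemma PMF.toOuterMeasure_ne_top {α : Type*} (p : PMF α) (S : Set α) : p.toOuterMeasure S ≠ ⊤ := by
  have h := ENNReal.tsum_le_tsum fun a => Set.indicator_le_self S p a
  rw [← PMF.toOuterMeasure_apply, p.tsum_coe] at h
  exact (h.trans_lt ENNReal.one_lt_top).ne

/-! ### Second moments along adaptive decision trees. -/

namespace QueryTree

/-- If every single reply of `O` satisfies a second-moment comparison with `O'` with constant `M`,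
then so does the output of a decision tree, with constant `M` to the number of queries. -/
lemma sq_run_le {n : ℕ} {O O' : Finset (Cube n) → PMF (Option (Cube n))} {M : ℝ} (hM : 1 ≤ M)
    (hstep : ∀ A : Finset (Cube n), A.Nonempty → ∀ g : Option (Cube n) → ℝ,
      (∑ r, (O A r).toReal * g r) ^ 2 ≤ M * ∑ r, (O' A r).toReal * g r ^ 2)
    (S : Set (PMF (Cube n))) (T : QueryTree n) :
    ∀ q : ℕ, T.depth ≤ q →
      ((T.run O).toOuterMeasure S).toReal ^ 2
        ≤ M ^ q * ((T.run O').toOuterMeasure S).toReal := by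
  have expand : ∀ (R : PMF (Option (Cube n))) (f : Option (Cube n) → PMF (PMF (Cube n))),
      ((R.bind f).toOuterMeasure S).toReal
        = ∑ r, (R r).toReal * ((f r).toOuterMeasure S).toReal := by
    intro R f
    rw [PMF.toOuterMeasure_bind_apply, tsum_fintype, ENNReal.toReal_sum]
    · simp [ENNReal.toReal_mul]
    · intro r _
      exact ENNReal.mul_ne_top (R.apply_ne_top r)
        (PMF.toOuterMeasure_ne_top _ _)
  induction T with
  | output hyp =>
    intro q _
    have h1 : (1 : ℝ) ≤ M ^ q := one_le_pow₀ hM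
    simp only [run, PMF.toOuterMeasure_pure_apply]
    split_ifs
    · simpa using h1
    · simp
  | query A hA next ih =>
    intro q hq
    obtain _ | q := q
    · simp [depth] at hq
    have hd : ∀ r, (next r).depth ≤ q := fun r => by
      have := Finset.le_sup (f := fun r => (next r).depth) (Finset.mem_univ r)
      simp only [depth] at hq
      omega
    simp only [run]
    rw [expand, expand]
    -- The test function `g` is the success probability of the subtree chosen by the reply.
    refine (hstep A hA _).trans ?_
    rw [pow_succ', mul_assoc]
    refine mul_le_mul_of_nonneg_left ?_ (by linarith)
    rw [Finset.mul_sum]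
    refine Finset.sum_le_sum fun r _ => ?_
    rw [mul_left_comm]
    exact mul_le_mul_of_nonneg_left (ih r q (hd r)) ENNReal.toReal_nonneg

end QueryTree

/-! ### Tilts of the uniform distribution and their distances. -/

lemma abs_units_eq_one (u : ℤˣ) : |((u : ℤ) : ℝ)| = 1 := by
  rcases Int.units_eq_one_or u with rfl | rfl <;> simp

lemma sq_units_eq_one (u : ℤˣ) : ((u : ℤ) : ℝ) ^ 2 = 1 := by
  rcases Int.units_eq_one_or u with rfl | rfl <;> simp

lemma card_cube (n : ℕ) : Fintype.card (Cube n) = 2 ^ n := by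
  simp

lemma one_add_mul_units_pos {δ : ℝ} (h0 : 0 ≤ δ) (h1 : δ ≤ 1 / 2) (u : ℤˣ) :
    0 < 1 + δ * ((u : ℤ) : ℝ) := by
  rcases Int.units_eq_one_or u with rfl | rfl <;> simp <;> linarith

/-- A sign pattern on the cube whose values cancel. -/
def IsBalancedSign {n : ℕ} (s : Cube n → ℤˣ) : Prop := ∑ x, ((s x : ℤ) : ℝ) = 0

lemma balanced_of_flip {n : ℕ} {s : Cube n → ℤˣ} (g : Cube n) (h : ∀ x, s (g * x) = -s x) :
    IsBalancedSign s := by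
  have h1 : ∑ x, ((s x : ℤ) : ℝ) = ∑ x, ((s (g * x) : ℤ) : ℝ) :=
    (Equiv.sum_comp (Equiv.mulLeft g) fun x => ((s x : ℤ) : ℝ)).symm
  simp only [h, Units.val_neg, Int.cast_neg, Finset.sum_neg_distrib] at h1
  unfold IsBalancedSign
  linarith

/-- The distribution with probability mass function `(1 + δ s(x)) / 2^n`. -/
noncomputable def tilt {n : ℕ} (s : Cube n → ℤˣ) (hs : IsBalancedSign s) (δ : ℝ) (h0 : 0 ≤ δ)
    (h1 : δ ≤ 1 / 2) : PMF (Cube n) :=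
  PMF.ofFintype (fun x => ENNReal.ofReal ((1 + δ * ((s x : ℤ) : ℝ)) / 2 ^ n)) <| by
    rw [← ENNReal.ofReal_sum_of_nonneg
      fun x _ => div_nonneg (one_add_mul_units_pos h0 h1 _).le (by positivity)]
    rw [← Finset.sum_div, Finset.sum_add_distrib, ← Finset.mul_sum, show _ = (0 : ℝ) from hs]
    simp

lemma tilt_toReal {n : ℕ} (s : Cube n → ℤˣ) (hs : IsBalancedSign s) {δ : ℝ} (h0 : 0 ≤ δ)
    (h1 : δ ≤ 1 / 2) (x : Cube n) :
    (tilt s hs δ h0 h1 x).toReal = (1 + δ * ((s x : ℤ) : ℝ)) / 2 ^ n := by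
  simp only [tilt, PMF.ofFintype_apply]
  exact ENNReal.toReal_ofReal (div_nonneg (one_add_mul_units_pos h0 h1 _).le (by positivity))

lemma isJuntaDist_tilt {n k : ℕ} {s : Cube n → ℤˣ} (hs : IsBalancedSign s) {δ : ℝ} (h0 : 0 ≤ δ)
    (h1 : δ ≤ 1 / 2) (J : Finset (Fin n)) (hJ : J.card ≤ k) (hd : DependsOn s (J : Set (Fin n))) :
    IsJuntaDist k (tilt s hs δ h0 h1) := by
  refine ⟨J, hJ, fun x y hxy => ?_⟩
  simp only [tilt, PMF.ofFintype_apply]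
  rw [hd hxy]

lemma dTV_tilt {n : ℕ} (s t : Cube n → ℤˣ) (hs : IsBalancedSign s) (ht : IsBalancedSign t) {δ : ℝ}
    (h0 : 0 ≤ δ) (h1 : δ ≤ 1 / 2) :
    dTV (tilt s hs δ h0 h1) (tilt t ht δ h0 h1)
      = δ / 2 * (∑ x, (1 - ((s x * t x : ℤˣ) : ℤ) : ℝ)) / 2 ^ n := by
  simp only [dTV, tilt_toReal, Finset.mul_sum, Finset.sum_div]
  refine Finset.sum_congr rfl fun x _ => ?_
  rw [← sub_div, abs_div, abs_of_pos (show (0 : ℝ) < 2 ^ n by positivity)]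
  rcases Int.units_eq_one_or (s x) with h | h <;> rcases Int.units_eq_one_or (t x) with h' | h' <;>
    simp only [h, h'] <;> norm_num
  · rw [abs_of_nonneg (by linarith)]; ring
  · rw [abs_of_nonpos (by linarith)]; ring

lemma dTV_comm {n : ℕ} (p q : PMF (Cube n)) : dTV p q = dTV q p := by
  simp only [dTV, abs_sub_comm]

lemma dTV_triangle {n : ℕ} (p q r : PMF (Cube n)) : dTV p r ≤ dTV p q + dTV q r := by
  simp only [dTV]
  rw [← mul_add, ← Finset.sum_add_distrib]
  exact mul_le_mul_of_nonneg_left (Finset.sum_le_sum fun x _ => abs_sub_le _ _ _) (by norm_num)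

/-! ### Conditional replies of a tilt compared with uniform. -/

open Classical in
-- Full support means that no nonempty query has probability zero, so `Z` plays no role.
lemma sum_condOracle {n : ℕ} (Z : ZeroRule n) (p : PMF (Cube n)) (hp : ∀ x, p x ≠ 0)
    {A : Finset (Cube n)} (hA : A.Nonempty) (g : Option (Cube n) → ℝ) :
    ∑ r, (condOracle Z p A r).toReal * g r
      = (∑ x ∈ A, (p x).toReal * g (some x)) / ∑ x ∈ A, (p x).toReal := by
  have h : ∃ x ∈ (A : Set (Cube n)), x ∈ p.support := by
    obtain ⟨x, hx⟩ := hA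
    exact ⟨x, hx, (PMF.mem_support_iff _ _).2 (hp x)⟩
  have hsome : ∀ (P : PMF (Cube n)) x, (P.map some) (some x) = P x := by
    intro P x
    rw [PMF.map_apply, tsum_eq_single x]
    · simp
    · intro y hy
      simp [Ne.symm hy]
  have hnone : ∀ (P : PMF (Cube n)), (P.map some) none = 0 := by
    intro P
    simp [PMF.map_apply]
  have hden : (∑' x, (A : Set (Cube n)).indicator p x) = ∑ x ∈ A, p x := by
    rw [tsum_fintype]
    simp [Set.indicator_apply, Finset.sum_ite_mem]
  rw [Fintype.sum_option, condOracle, dif_pos h]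
  simp only [hsome, hnone, PMF.filter_apply, hden]
  rw [← ENNReal.toReal_sum fun x _ => p.apply_ne_top x, Finset.sum_div]
  simp only [ENNReal.toReal_zero, zero_mul, zero_add, ENNReal.toReal_mul, ENNReal.toReal_inv]
  rw [← Finset.sum_subset (Finset.subset_univ A)]
  · refine Finset.sum_congr rfl fun x hx => ?_
    rw [Set.indicator_of_mem (by exact_mod_cast hx)]
    ring
  · intro x _ hx
    rw [Set.indicator_of_notMem (by exact_mod_cast hx)]
    simp

/-- On every conditional query, the replies for a tilted distribution and for the uniform
distribution have chi-square divergence at most `4 δ ^ 2`. -/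
lemma sq_sum_condOracle_tilt_le {n : ℕ} (Z : ZeroRule n) (s t : Cube n → ℤˣ) (hs : IsBalancedSign s)
    (ht : IsBalancedSign t) {δ : ℝ} (h0 : 0 ≤ δ) (h1 : δ ≤ 1 / 2) {A : Finset (Cube n)}
    (hA : A.Nonempty) (g : Option (Cube n) → ℝ) :
    (∑ r, (condOracle Z (tilt s hs δ h0 h1) A r).toReal * g r) ^ 2
      ≤ (1 + 4 * δ ^ 2) *
        ∑ r, (condOracle Z (tilt t ht 0 le_rfl (by norm_num)) A r).toReal * g r ^ 2 := by
  have hpos : ∀ (u : Cube n → ℤˣ) (hu : IsBalancedSign u) (η : ℝ) (h : 0 ≤ η) (h' : η ≤ 1 / 2) x,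
      tilt u hu η h h' x ≠ 0 := by
    intro u hu η h h' x hx
    have := tilt_toReal u hu h h' x
    rw [hx, ENNReal.toReal_zero] at this
    have := div_pos (one_add_mul_units_pos h h' (u x)) (show (0 : ℝ) < 2 ^ n by positivity)
    linarith
  rw [sum_condOracle Z _ (hpos _ _ _ _ _) hA, sum_condOracle Z _ (hpos _ _ _ _ _) hA (fun r => g r ^ 2)]
  simp only [tilt_toReal, zero_mul, add_zero]
  have hc : (0 : ℝ) < 2 ^ n := by positivity
  have e1 : (∑ x ∈ A, (1 + δ * ((s x : ℤ) : ℝ)) / 2 ^ n * g (some x)) /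
      ∑ x ∈ A, (1 + δ * ((s x : ℤ) : ℝ)) / 2 ^ n
      = (∑ x ∈ A, (1 + δ * ((s x : ℤ) : ℝ)) * g (some x)) /
        ∑ x ∈ A, (1 + δ * ((s x : ℤ) : ℝ)) := by
    simp only [div_mul_eq_mul_div]
    rw [← Finset.sum_div, ← Finset.sum_div, div_div_div_cancel_right₀ hc.ne']
  have e2 : (∑ x ∈ A, (1 : ℝ) / 2 ^ n * g (some x) ^ 2) / ∑ x ∈ A, (1 : ℝ) / 2 ^ n
      = (∑ x ∈ A, g (some x) ^ 2) / A.card := by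
    rw [← Finset.mul_sum, ← mul_div_mul_left _ (A.card : ℝ) (show (1 : ℝ) / 2 ^ n ≠ 0 by positivity)]
    simp [mul_comm]
  rw [e1, e2]
  have ha : (0 : ℝ) < A.card := by exact_mod_cast hA.card_pos
  set a : ℝ := (A.card : ℝ)
  set S : ℝ := ∑ x ∈ A, ((s x : ℤ) : ℝ) with hS
  have hSabs : |S| ≤ a := by
    refine (Finset.abs_sum_le_sum_abs _ _).trans ?_
    simp [abs_units_eq_one, a]
  have hW : ∑ x ∈ A, (1 + δ * ((s x : ℤ) : ℝ)) = a + δ * S := by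
    rw [Finset.sum_add_distrib, ← Finset.mul_sum]
    simp [a, hS]
  have hW2 : ∑ x ∈ A, (1 + δ * ((s x : ℤ) : ℝ)) ^ 2 = a + 2 * δ * S + δ ^ 2 * a := by
    have : ∀ x ∈ A, (1 + δ * ((s x : ℤ) : ℝ)) ^ 2 = 1 + 2 * δ * ((s x : ℤ) : ℝ) + δ ^ 2 := by
      intro x _
      linear_combination δ ^ 2 * sq_units_eq_one (s x)
    rw [Finset.sum_congr rfl this, Finset.sum_add_distrib, Finset.sum_add_distrib, ← Finset.mul_sum]
    simp [a, hS, mul_comm]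
  have hCS := Finset.sum_mul_sq_le_sq_mul_sq A (fun x => 1 + δ * ((s x : ℤ) : ℝ))
    (fun x => g (some x))
  rw [hW2] at hCS
  rw [hW]
  have hWlow : a / 2 ≤ a + δ * S := by
    have := (abs_le.1 hSabs).1
    nlinarith
  have hWpos : 0 < a + δ * S := by linarith
  -- The left side is `(a + δS)² + δ²(a² - S²)`, and `a ≤ 2(a + δS)`.
  have key : a * (a + 2 * δ * S + δ ^ 2 * a) ≤ (1 + 4 * δ ^ 2) * (a + δ * S) ^ 2 := by
    have h2 : (a / 2) ^ 2 ≤ (a + δ * S) ^ 2 := by gcongr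
    nlinarith [sq_nonneg (δ * S), mul_le_mul_of_nonneg_left h2 (sq_nonneg δ)]
  have hG : 0 ≤ ∑ x ∈ A, g (some x) ^ 2 := Finset.sum_nonneg fun _ _ => sq_nonneg _
  rw [div_pow, ← mul_div_assoc, div_le_div_iff₀ (by positivity) ha]
  calc _ ≤ ((a + 2 * δ * S + δ ^ 2 * a) * ∑ x ∈ A, g (some x) ^ 2) * a := by gcongr
    _ = (a * (a + 2 * δ * S + δ ^ 2 * a)) * ∑ x ∈ A, g (some x) ^ 2 := by ring
    _ ≤ ((1 + 4 * δ ^ 2) * (a + δ * S) ^ 2) * ∑ x ∈ A, g (some x) ^ 2 := by gcongr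
    _ = _ := by ring

/-! ### Averaging over a finite family of tilts. -/

lemma sum_lintegral_le_lintegral_sum {Ω ι : Type*} [MeasurableSpace Ω] (P : Measure Ω)
    (f : ι → Ω → ℝ≥0∞) (s : Finset ι) :
    ∑ i ∈ s, ∫⁻ ω, f i ω ∂P ≤ ∫⁻ ω, ∑ i ∈ s, f i ω ∂P := by
  classical
  induction s using Finset.induction_on with
  | empty => simp
  | insert i s hi ih =>
    simp only [Finset.sum_insert hi]
    -- The lower integral is superadditive even for nonmeasurable functions, so `alg` needs no
    -- measurability.
    exact (add_le_add le_rfl ih).trans (le_lintegral_add _ _)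

open Classical in
lemma sum_toOuterMeasure_le {α ι : Type*} [Fintype ι] (Q : PMF α) (S : ι → Set α) (L : ℕ)
    (hL : ∀ a, (Finset.univ.filter fun i => a ∈ S i).card ≤ L) :
    ∑ i, (Q.toOuterMeasure (S i)).toReal ≤ L := by
  have hfin : ∀ i, Q.toOuterMeasure (S i) ≠ ⊤ := fun i =>
    PMF.toOuterMeasure_ne_top _ _
  rw [← ENNReal.toReal_sum fun i _ => hfin i]
  have : ∑ i, Q.toOuterMeasure (S i) ≤ (L : ℝ≥0∞) := by
    simp only [PMF.toOuterMeasure_apply]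
    rw [← Summable.tsum_finsetSum fun i _ => ENNReal.summable]
    calc ∑' a, ∑ i, (S i).indicator Q a ≤ ∑' a, (L : ℝ≥0∞) * Q a := by
          refine ENNReal.tsum_le_tsum fun a => ?_
          simp only [Set.indicator_apply]
          rw [← Finset.sum_filter, Finset.sum_const, nsmul_eq_mul]
          gcongr
          exact_mod_cast hL a
      _ = L := by rw [ENNReal.tsum_mul_left, Q.tsum_coe, mul_one]
  simpa using ENNReal.toReal_mono (ENNReal.natCast_ne_top L) this

open Classical in
/-- A learner of a finite family of tilted distributions, of which no hypothesis approximates more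
than `L`, needs many queries. -/
lemma card_le_of_learnsJuntas {n k : ℕ} {ε δ : ℝ} (h0 : 0 ≤ δ) (h1 : δ ≤ 1 / 2)
    {Z : ZeroRule n} {Ω : Type*} [MeasurableSpace Ω] {P : Measure Ω} [IsProbabilityMeasure P]
    {alg : Ω → QueryTree n} {q : ℕ} (hq : ∀ ω, (alg ω).depth ≤ q)
    (hlearn : LearnsJuntas P Z k ε alg) {ι : Type*} [Fintype ι] [Nonempty ι]
    (s : ι → Cube n → ℤˣ) (hs : ∀ i, IsBalancedSign (s i))
    (hj : ∀ i, IsJuntaDist k (tilt (s i) (hs i) δ h0 h1)) (L : ℕ)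
    (hL : ∀ hyp, (Finset.univ.filter fun i => dTV (tilt (s i) (hs i) δ h0 h1) hyp ≤ ε).card ≤ L) :
    16 * (Fintype.card ι : ℝ) ≤ 25 * (1 + 4 * δ ^ 2) ^ q * L := by
  obtain ⟨i₀⟩ := ‹Nonempty ι›
  have hN : (0 : ℝ) < Fintype.card ι := by exact_mod_cast Fintype.card_pos_iff.2 ⟨i₀⟩
  set N : ℝ := (Fintype.card ι : ℝ) with hNdef
  set M : ℝ := 1 + 4 * δ ^ 2 with hMdef
  have hM : 1 ≤ M := by nlinarith [sq_nonneg δ]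
  have hM0 : 0 ≤ M := by linarith
  have hpt : ∀ ω, ∑ i, (alg ω).successProb Z ε (tilt (s i) (hs i) δ h0 h1)
      ≤ ENNReal.ofReal (√(N * (M ^ q * L))) := by
    intro ω
    have hfin : ∀ i, (alg ω).successProb Z ε (tilt (s i) (hs i) δ h0 h1) ≠ ⊤ := fun i =>
      PMF.toOuterMeasure_ne_top _ _
    rw [← ENNReal.ofReal_toReal (ENNReal.sum_ne_top.2 fun i _ => hfin i)]
    refine ENNReal.ofReal_le_ofReal (Real.le_sqrt_of_sq_le ?_)
    rw [ENNReal.toReal_sum fun i _ => hfin i]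
    refine sq_sum_le_card_mul_sum_sq.trans ?_
    rw [Finset.card_univ]
    refine mul_le_mul_of_nonneg_left ?_ hN.le
    -- Tilting by `0` is the uniform distribution; `s i₀` merely supplies a balanced sign.
    calc _ ≤ ∑ i, M ^ q * (((alg ω).run
            (condOracle Z (tilt (s i₀) (hs i₀) 0 le_rfl (by norm_num)))).toOuterMeasure
              {hyp | dTV (tilt (s i) (hs i) δ h0 h1) hyp ≤ ε}).toReal := by
          refine Finset.sum_le_sum fun i _ => ?_
          exact QueryTree.sq_run_le hM (fun A hA g =>
            sq_sum_condOracle_tilt_le Z (s i) (s i₀) (hs i) (hs i₀) h0 h1 hA g) _ _ q (hq ω)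
      _ ≤ M ^ q * L := by
          rw [← Finset.mul_sum]
          exact mul_le_mul_of_nonneg_left (sum_toOuterMeasure_le _ _ L hL) (by positivity)
  have hint : ∑ _i : ι, (4 / 5 : ℝ≥0∞) ≤ ENNReal.ofReal (√(N * (M ^ q * L))) :=
    calc ∑ _i : ι, (4 / 5 : ℝ≥0∞)
        ≤ ∑ i, ∫⁻ ω, (alg ω).successProb Z ε (tilt (s i) (hs i) δ h0 h1) ∂P :=
          Finset.sum_le_sum fun i _ => hlearn _ (hj i)
      _ ≤ ∫⁻ ω, ∑ i, (alg ω).successProb Z ε (tilt (s i) (hs i) δ h0 h1) ∂P :=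
          sum_lintegral_le_lintegral_sum _ _ _
      _ ≤ ∫⁻ _, ENNReal.ofReal (√(N * (M ^ q * L))) ∂P := lintegral_mono hpt
      _ = _ := by simp
  have hreal : N * (4 / 5) ≤ √(N * (M ^ q * L)) := by
    have := ENNReal.toReal_mono ENNReal.ofReal_ne_top hint
    rw [ENNReal.toReal_ofReal (Real.sqrt_nonneg _)] at this
    simpa [ENNReal.toReal_div] using this
  have hsq : (N * (4 / 5)) ^ 2 ≤ N * (M ^ q * L) :=
    (Real.le_sqrt (by positivity) (by positivity)).1 hreal
  have : N * (16 * N) ≤ N * (25 * M ^ q * L) := by nlinarith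
  exact le_of_mul_le_mul_left this hN

/-- Two tilted distributions with a common `ε`-approximation have strongly correlated signs. -/
lemma sum_one_sub_mul_le {n : ℕ} {ε : ℝ} (hε : 0 < ε) {s t : Cube n → ℤˣ} (hs : IsBalancedSign s)
    (ht : IsBalancedSign t) (h0 : 0 ≤ 60 * ε) (h1 : 60 * ε ≤ 1 / 2) {hyp : PMF (Cube n)}
    (h : dTV (tilt s hs (60 * ε) h0 h1) hyp ≤ ε) (h' : dTV (tilt t ht (60 * ε) h0 h1) hyp ≤ ε) :
    15 * ∑ x, (1 - ((s x * t x : ℤˣ) : ℤ) : ℝ) ≤ 2 ^ n := by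
  have h3 := dTV_triangle (tilt s hs (60 * ε) h0 h1) hyp (tilt t ht (60 * ε) h0 h1)
  rw [dTV_comm hyp, dTV_tilt s t hs ht h0 h1] at h3
  have hc : (0 : ℝ) < 2 ^ n := by positivity
  have h4 := (div_le_iff₀ hc).1 (h3.trans (add_le_add h h'))
  -- The distance is `30ε` times the normalized sum and at most `2ε`, hence the factor `15`.
  refine le_of_mul_le_mul_left ?_ (show 0 < 2 * ε by linarith)
  linarith

/-! ### Parities and the binomial term. -/

/-- The character of the cube given by the product of the coordinates in `J`. -/
def parity {n : ℕ} (J : Finset (Fin n)) (x : Cube n) : ℤˣ := ∏ i ∈ J, x i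

lemma parity_mul {n : ℕ} (J : Finset (Fin n)) (x y : Cube n) :
    parity J (x * y) = parity J x * parity J y := by
  simp [parity, Finset.prod_mul_distrib]

lemma parity_mulSingle {n : ℕ} (J : Finset (Fin n)) (i : Fin n) :
    parity J (Pi.mulSingle i (-1)) = if i ∈ J then -1 else 1 := by
  simp [parity, Pi.mulSingle_apply, Finset.prod_ite_eq']

lemma dependsOn_parity {n : ℕ} (J : Finset (Fin n)) :
    DependsOn (parity J) (J : Set (Fin n)) := fun _ _ h =>
  Finset.prod_congr rfl fun i hi => h i hi

lemma balanced_parity {n : ℕ} {J : Finset (Fin n)} (hJ : J.Nonempty) : IsBalancedSign (parity J) := by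
  obtain ⟨i, hi⟩ := hJ
  refine balanced_of_flip (Pi.mulSingle i (-1)) fun x => ?_
  rw [parity_mul, parity_mulSingle, if_pos hi, neg_one_mul]

lemma balanced_parity_mul {n : ℕ} {J K : Finset (Fin n)} (h : ¬ J ⊆ K) :
    IsBalancedSign fun x => parity J x * parity K x := by
  obtain ⟨i, hi, hi'⟩ := Finset.not_subset.1 h
  refine balanced_of_flip (Pi.mulSingle i (-1)) fun x => ?_
  simp only [parity_mul, parity_mulSingle, if_pos hi, if_neg hi', one_mul, neg_mul]

lemma choose_le_of_learnsJuntas {n k : ℕ} {ε : ℝ} (hk : 0 < k) (hkn : k < n) (hε : 0 < ε)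
    (hε' : ε ≤ 1 / 120) {Z : ZeroRule n} {Ω : Type*} [MeasurableSpace Ω] {P : Measure Ω}
    [IsProbabilityMeasure P] {alg : Ω → QueryTree n} {q : ℕ} (hq : ∀ ω, (alg ω).depth ≤ q)
    (hlearn : LearnsJuntas P Z k ε alg) :
    16 * (n.choose k : ℝ) ≤ 25 * (1 + 4 * (60 * ε) ^ 2) ^ q := by
  classical
  have h0 : 0 ≤ 60 * ε := by linarith
  have h1 : 60 * ε ≤ 1 / 2 := by linarith
  have hcard : Fintype.card {J : Finset (Fin n) // J.card = k} = n.choose k := by simp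
  have : Nonempty {J : Finset (Fin n) // J.card = k} := by
    rw [← Fintype.card_pos_iff, hcard]
    exact Nat.choose_pos hkn.le
  have hb : ∀ J : {J : Finset (Fin n) // J.card = k}, IsBalancedSign (parity J.1) := fun J =>
    balanced_parity (Finset.card_pos.1 (hk.trans_eq J.2.symm))
  have := card_le_of_learnsJuntas h0 h1 hq hlearn
    (fun J : {J : Finset (Fin n) // J.card = k} => parity J.1) hb
    (fun J => isJuntaDist_tilt _ h0 h1 J.1 J.2.le (dependsOn_parity _)) 1 (fun hyp => by
      refine Finset.card_le_one.2 fun J hJ K hK => ?_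
      simp only [Finset.mem_filter, Finset.mem_univ, true_and] at hJ hK
      by_contra hne
      have hsub : ¬ J.1 ⊆ K.1 := fun hs =>
        hne (Subtype.ext (Finset.eq_of_subset_of_card_le hs (by rw [J.2, K.2])))
      -- Distinct parities are orthogonal, so the sum is `2^n`, giving `15 * 2^n ≤ 2^n`.
      have hle := sum_one_sub_mul_le hε (hb J) (hb K) h0 h1 hJ hK
      have hz : ∑ x, (((parity J.1 x * parity K.1 x : ℤˣ) : ℤ) : ℝ) = (0 : ℝ) :=
        balanced_parity_mul hsub
      rw [Finset.sum_sub_distrib, hz] at hle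
      simp at hle)
  rw [hcard] at this
  simpa using this

/-! ### Hamming balls, sign patterns and the `2^k` term. -/

lemma sum_pow_hammingDist {Y : Type*} [Fintype Y] [DecidableEq Y] (t₀ : Y → ℤˣ) (z : ℝ) :
    ∑ t : Y → ℤˣ, z ^ hammingDist t t₀ = (1 + z) ^ Fintype.card Y := by
  have h : ∀ t : Y → ℤˣ, z ^ hammingDist t t₀ = ∏ y, if t y ≠ t₀ y then z else 1 := by
    intro t
    rw [Finset.prod_ite]
    simp [hammingDist]
  simp only [h]
  rw [← Fintype.prod_sum (fun y (v : ℤˣ) => if v ≠ t₀ y then z else 1)]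
  have h2 : ∀ y, (∑ v : ℤˣ, if v ≠ t₀ y then z else 1) = 1 + z := by
    intro y
    rcases Int.units_eq_one_or (t₀ y) with h | h <;> rw [h] <;>
      simp [UnitsInt.univ, add_comm]
  simp only [h2, Finset.prod_const, Finset.card_univ]

/-- The number of sign patterns in a Hamming ball whose radius is a thirtieth of the length. -/
lemma card_hamming_ball_pow_le {Y : Type*} [Fintype Y] [DecidableEq Y] (t₀ : Y → ℤˣ) :
    ((Finset.univ.filter fun t : Y → ℤˣ => hammingDist t t₀ ≤ Fintype.card Y / 30).card : ℝ) ^ 10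
      ≤ (2 * (9 / 8) ^ 10) ^ Fintype.card Y := by
  set m := Fintype.card Y
  set B := Finset.univ.filter fun t : Y → ℤˣ => hammingDist t t₀ ≤ m / 30
  -- Chernoff's method with `z = 1/8`; the tenth power later turns `8^(m/30)` into at most `2^m`.
  have h1 : (B.card : ℝ) * (1 / 8) ^ (m / 30) ≤ (9 / 8) ^ m :=
    calc (B.card : ℝ) * (1 / 8) ^ (m / 30) = ∑ t ∈ B, (1 / 8 : ℝ) ^ (m / 30) := by simp
      _ ≤ ∑ t ∈ B, (1 / 8 : ℝ) ^ hammingDist t t₀ := by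
          refine Finset.sum_le_sum fun t ht => ?_
          exact pow_le_pow_of_le_one (by norm_num) (by norm_num) (Finset.mem_filter.1 ht).2
      _ ≤ ∑ t, (1 / 8 : ℝ) ^ hammingDist t t₀ :=
          Finset.sum_le_sum_of_subset_of_nonneg (Finset.subset_univ _) fun _ _ _ => by positivity
      _ = (9 / 8) ^ m := by rw [sum_pow_hammingDist]; norm_num [m]
  have h2 : (B.card : ℝ) ≤ (9 / 8) ^ m * 8 ^ (m / 30) := by
    rw [one_div, inv_pow, ← div_eq_mul_inv, div_le_iff₀ (by positivity)] at h1
    exact h1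
  calc (B.card : ℝ) ^ 10 ≤ ((9 / 8) ^ m * 8 ^ (m / 30)) ^ 10 := by gcongr
    _ = ((9 / 8) ^ 10) ^ m * 2 ^ (30 * (m / 30)) := by
        rw [mul_pow, ← pow_mul, ← pow_mul, ← pow_mul, show (8 : ℝ) = 2 ^ 3 by norm_num, ← pow_mul,
          mul_comm m 10]
        congr 2
        ring
    _ ≤ ((9 / 8) ^ 10) ^ m * 2 ^ m := by
        gcongr
        · norm_num
        · omega
    _ = _ := by rw [← mul_pow, mul_comm]

/-- The sign pattern `x ↦ x i * t (x restricted to the coordinates satisfying p)`. -/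
def signedPattern {n : ℕ} (p : Fin n → Prop) (i : Fin n) (t : ({j // p j} → ℤˣ) → ℤˣ)
    (x : Cube n) : ℤˣ := x i * t fun j => x j

/-- Flipping coordinate `i` negates the pattern without touching the argument of `t`, so `t` may be
arbitrary. -/
lemma balanced_signedPattern {n : ℕ} {p : Fin n → Prop} {i : Fin n} (hi : ¬ p i)
    (t : ({j // p j} → ℤˣ) → ℤˣ) : IsBalancedSign (signedPattern p i t) := by
  refine balanced_of_flip (Pi.mulSingle i (-1)) fun x => ?_
  have h : (fun j : {j // p j} => (Pi.mulSingle i (-1) * x : Cube n) j) = fun j : {j // p j} => x j := by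
    funext j
    have : (j : Fin n) ≠ i := fun h => hi (h ▸ j.2)
    simp [Pi.mulSingle_eq_of_ne this]
  simp only [signedPattern, h]
  simp

lemma sum_restrict {n : ℕ} (p : Fin n → Prop) [DecidablePred p] (f : ({j // p j} → ℤˣ) → ℝ) :
    (Fintype.card ({j // p j} → ℤˣ) : ℝ) * ∑ x : Cube n, f (fun j => x j) = 2 ^ n * ∑ y, f y := by
  have e := Equiv.piEquivPiSubtypeProd p (fun _ : Fin n => ℤˣ)
  have h1 : ∑ x : Cube n, f (fun j => x j)
      = Fintype.card ({j // ¬ p j} → ℤˣ) * ∑ y, f y := by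
    refine (Equiv.sum_comp (Equiv.piEquivPiSubtypeProd p (fun _ : Fin n => ℤˣ))
      (fun z => f z.1)).trans ?_
    rw [Fintype.sum_prod_type]
    simp only [Finset.sum_const, Finset.card_univ, nsmul_eq_mul, Finset.mul_sum]
  have h2 : (2 : ℝ) ^ n
      = Fintype.card ({j // p j} → ℤˣ) * Fintype.card ({j // ¬ p j} → ℤˣ) := by
    rw [← Nat.cast_mul, ← Fintype.card_prod, ← Fintype.card_congr e, card_cube]
    simp
  rw [h1, h2, mul_assoc]

lemma sum_one_sub_signedPattern {n : ℕ} (p : Fin n → Prop) [DecidablePred p] (i : Fin n)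
    (t t' : ({j // p j} → ℤˣ) → ℤˣ) :
    (Fintype.card ({j // p j} → ℤˣ) : ℝ) *
      ∑ x, (1 - ((signedPattern p i t x * signedPattern p i t' x : ℤˣ) : ℤ) : ℝ)
      = 2 ^ n * (2 * hammingDist t t') := by
  have h : ∀ x, (1 - ((signedPattern p i t x * signedPattern p i t' x : ℤˣ) : ℤ) : ℝ)
      = (fun y => if t y ≠ t' y then (2 : ℝ) else 0) (fun j => x j) := by
    intro x
    have : signedPattern p i t x * signedPattern p i t' x
        = t (fun j => x j) * t' (fun j => x j) := by
      simp only [signedPattern]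
      rw [mul_mul_mul_comm, Int.units_mul_self, one_mul]
    rw [this]
    rcases Int.units_eq_one_or (t fun j => x j) with h | h <;>
      rcases Int.units_eq_one_or (t' fun j => x j) with h' | h' <;> simp [h, h'] <;> norm_num
  simp only [h]
  rw [sum_restrict p (fun y => if t y ≠ t' y then (2 : ℝ) else 0), ← Finset.sum_filter]
  simp [hammingDist, mul_comm]

/-- Here `k` coordinates feed `t` and one more carries the sign, whence `k + 1`. Tenth powers keep
the entropy estimate rational. -/
lemma two_pow_le_of_learnsJuntas {n k : ℕ} {ε : ℝ} (hkn : k < n) (hε : 0 < ε)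
    (hε' : ε ≤ 1 / 120) {Z : ZeroRule n} {Ω : Type*} [MeasurableSpace Ω] {P : Measure Ω}
    [IsProbabilityMeasure P] {alg : Ω → QueryTree n} {q : ℕ} (hq : ∀ ω, (alg ω).depth ≤ q)
    (hlearn : LearnsJuntas P Z (k + 1) ε alg) :
    (9 / 5 : ℝ) ^ (2 ^ k) ≤ ((1 + 4 * (60 * ε) ^ 2) ^ q) ^ 10 := by
  classical
  have h0 : 0 ≤ 60 * ε := by linarith
  have h1 : 60 * ε ≤ 1 / 2 := by linarith
  let p : Fin n → Prop := fun j => (j : ℕ) < k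
  let i : Fin n := ⟨k, hkn⟩
  have hi : ¬ p i := lt_irrefl k
  have hfilter : (Finset.univ.filter p).card = k := by
    rw [Fin.card_filter_val_lt]
    omega
  set m := Fintype.card ({j // p j} → ℤˣ) with hm
  have hmk : m = 2 ^ k := by
    rw [hm, Fintype.card_fun, Fintype.card_subtype, hfilter]
    simp
  have hm0 : (0 : ℝ) < m := by rw [hmk]; positivity
  have hcard : (Fintype.card (({j // p j} → ℤˣ) → ℤˣ) : ℝ) = 2 ^ m := by
    rw [Fintype.card_fun]
    simp [hm]
  have hb := fun t => balanced_signedPattern hi t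
  set L := ⌊((2 * (9 / 8 : ℝ) ^ 10) ^ m) ^ (10 : ℝ)⁻¹⌋₊ with hLdef
  have hLpow : (L : ℝ) ^ 10 ≤ (2 * (9 / 8) ^ 10) ^ m := by
    calc (L : ℝ) ^ 10 ≤ (((2 * (9 / 8 : ℝ) ^ 10) ^ m) ^ (10 : ℝ)⁻¹) ^ 10 := by
          gcongr
          exact Nat.floor_le (by positivity)
      _ = _ := by
          rw [← Real.rpow_natCast, ← Real.rpow_mul (by positivity)]
          norm_num
  have hmain := card_le_of_learnsJuntas h0 h1 hq hlearn
    (fun t : ({j // p j} → ℤˣ) → ℤˣ => signedPattern p i t) hb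
    (fun t => isJuntaDist_tilt _ h0 h1 (insert i (Finset.univ.filter p))
      ((Finset.card_insert_le _ _).trans_eq (by rw [hfilter])) (fun x y hxy => by
        have hx : (fun j : {j // p j} => x j) = fun j : {j // p j} => y j := by
          funext j
          exact hxy j (by simp)
        simp only [signedPattern]
        rw [hx, hxy i (by simp)])) L (fun hyp => by
      rcases Finset.eq_empty_or_nonempty (Finset.univ.filter fun t : ({j // p j} → ℤˣ) → ℤˣ =>
        dTV (tilt (signedPattern p i t) (hb t) (60 * ε) h0 h1) hyp ≤ ε) with he | ⟨t₀, ht₀⟩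
      · rw [he]; simp
      have ht₀' := (Finset.mem_filter.1 ht₀).2
      refine (Finset.card_le_card (t := Finset.univ.filter
        fun t : ({j // p j} → ℤˣ) → ℤˣ => hammingDist t t₀ ≤ m / 30) fun t ht => ?_).trans ?_
      · refine Finset.mem_filter.2 ⟨Finset.mem_univ _, ?_⟩
        have hle := sum_one_sub_mul_le hε (hb t) (hb t₀) h0 h1 (Finset.mem_filter.1 ht).2 ht₀'
        have heq := sum_one_sub_signedPattern p i t t₀
        rw [← hm] at heq
        have h2n : (0 : ℝ) < 2 ^ n := by positivity
        have h30 : (30 : ℝ) * hammingDist t t₀ ≤ m := by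
          refine le_of_mul_le_mul_left ?_ h2n
          nlinarith [mul_le_mul_of_nonneg_left hle hm0.le]
        have h30' : 30 * hammingDist t t₀ ≤ m := by exact_mod_cast h30
        omega
      · refine Nat.le_floor ?_
        rw [Real.le_rpow_inv_iff_of_pos (by positivity) (by positivity) (by norm_num)]
        have := card_hamming_ball_pow_le t₀
        rw [← hm] at this
        exact_mod_cast this)
  rw [hcard] at hmain
  set M := 1 + 4 * (60 * ε) ^ 2
  have hM : 0 ≤ M ^ q := by positivity
  have hten : (16 * (2 : ℝ) ^ m) ^ 10 ≤ (25 * M ^ q * L) ^ 10 := by gcongr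
  -- Since `m ≥ 1`, the loss `16/25` can be charged to each of the `m` factors; what remains is `9/5
  -- * 2 * (9/8)^10 ≤ (32/25)^10`.
  have hconst : ((16 / 25 : ℝ) ^ 10) ^ m ≤ (16 / 25 : ℝ) ^ 10 := by
    refine pow_le_of_le_one (by positivity) (by norm_num) ?_
    exact_mod_cast hm0.ne'
  rw [← hmk]
  have hpos : (0 : ℝ) < (2 * (9 / 8) ^ 10) ^ m := by positivity
  refine le_of_mul_le_mul_right ?_ hpos
  calc (9 / 5 : ℝ) ^ m * (2 * (9 / 8) ^ 10) ^ m = (9 / 5 * (2 * (9 / 8) ^ 10)) ^ m := by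
        exact (mul_pow _ _ _).symm
    _ ≤ ((16 / 25) ^ 10 * 2 ^ 10) ^ m := pow_le_pow_left₀ (by norm_num) (by norm_num) m
    _ = ((16 / 25 : ℝ) ^ 10) ^ m * (2 ^ m) ^ 10 := by rw [mul_pow, pow_right_comm 2]
    _ ≤ (16 / 25 : ℝ) ^ 10 * (2 ^ m) ^ 10 := by gcongr
    _ = (16 * (2 : ℝ) ^ m) ^ 10 / 25 ^ 10 := by ring
    _ ≤ (25 * M ^ q * L) ^ 10 / 25 ^ 10 := by gcongr
    _ = (M ^ q) ^ 10 * (L : ℝ) ^ 10 := by ring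
    _ ≤ (M ^ q) ^ 10 * (2 * (9 / 8) ^ 10) ^ m := by gcongr

/-! ### Logarithms and final constants. -/

lemma one_add_pow_le_exp {x : ℝ} (hx : 0 ≤ x) (q : ℕ) : (1 + x) ^ q ≤ Real.exp (q * x) := by
  rw [Real.exp_nat_mul]
  gcongr
  linarith [Real.add_one_le_exp x]

theorem theorem4 :
    ∃ c₁ > (0 : ℝ), ∃ c₂ > (0 : ℝ),
      ∀ (n k : ℕ) (ε : ℝ), 0 < k → k < n → 0 < ε → ε ≤ 1 / 120 →
      ∀ (Z : ZeroRule n) (Ω : Type*) [MeasurableSpace Ω] (P : Measure Ω) [IsProbabilityMeasure P]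
        (alg : Ω → QueryTree n) (q : ℕ),
        (∀ ω, (alg ω).depth ≤ q) →
        LearnsJuntas P Z k ε alg →
        c₁ * (Real.logb 2 (n.choose k : ℝ) / ε ^ 2) + c₂ * ((2 : ℝ) ^ k / ε ^ 2) ≤ (q : ℝ) := by
  -- Half the reciprocals of `115200` and `576000`: each of the two bounds pays for `q / 2`.
  refine ⟨1 / 230400, by norm_num, 1 / 1152000, by norm_num, ?_⟩
  intro n k ε hk hkn hε hε' Z Ω _ P _ alg q hq hlearn
  have hε2 : 0 < ε ^ 2 := by positivity
  have hexp : (1 + 4 * (60 * ε) ^ 2) ^ q ≤ Real.exp (q * (4 * (60 * ε) ^ 2)) :=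
    one_add_pow_le_exp (by positivity) q
  have hchoose : Real.logb 2 (n.choose k : ℝ) ≤ 115200 * ε ^ 2 * q := by
    have h := (choose_le_of_learnsJuntas hk hkn hε hε' hq hlearn).trans
      (mul_le_mul_of_nonneg_left hexp (by norm_num))
    have h2 : (2 : ℝ) ≤ n.choose k := by
      have : 2 ≤ n.choose k := by
        obtain ⟨m, rfl⟩ : ∃ m, n = m + 1 := ⟨n - 1, by omega⟩
        obtain ⟨j, rfl⟩ : ∃ j, k = j + 1 := ⟨k - 1, by omega⟩
        have h3 := Nat.choose_pos (show j ≤ m by omega)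
        have h4 := Nat.choose_pos (show j + 1 ≤ m by omega)
        rw [Nat.choose_succ_succ]
        exact Nat.add_le_add h3 h4
      exact_mod_cast this
    set N : ℝ := (n.choose k : ℝ)
    -- A fourth power absorbs the constant: `N ≥ 2` and `(16/25)^4 * 2^3 > 1`.
    have h4 : N ≤ Real.exp (q * (4 * (60 * ε) ^ 2)) ^ 4 := by
      set E := Real.exp (q * (4 * (60 * ε) ^ 2))
      have h5 : (16 / 25 * N) ^ 4 ≤ E ^ 4 := by
        gcongr
        linarith
      have h6 : N * 2 ^ 3 ≤ N * N ^ 3 := by gcongr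
      nlinarith
    rw [← Real.exp_nat_mul] at h4
    have h7 := (Real.log_le_iff_le_exp (by linarith)).2 h4
    rw [Real.logb, div_le_iff₀ (Real.log_pos (by norm_num))]
    have h8 := Real.log_two_gt_d9
    have h9 : 0 ≤ ε ^ 2 * q := by positivity
    push_cast at h7
    nlinarith
  have htwo : (2 : ℝ) ^ k ≤ 576000 * ε ^ 2 * q := by
    obtain ⟨j, rfl⟩ : ∃ j, k = j + 1 := ⟨k - 1, by omega⟩
    have h := (two_pow_le_of_learnsJuntas (by omega) hε hε' hq hlearn).trans
      (pow_le_pow_left₀ (by positivity) hexp 10)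
    rw [← Real.exp_nat_mul] at h
    have h2 := (Real.log_le_iff_le_exp (by positivity)).2 h
    have h3 : (1 / 2 : ℝ) ≤ Real.log (9 / 5) := by
      rw [Real.le_log_iff_exp_le (by norm_num)]
      refine (sq_le_sq₀ (Real.exp_pos _).le (by norm_num)).1 ?_
      rw [← Real.exp_nat_mul]
      norm_num
      linarith [Real.exp_one_lt_d9]
    rw [Real.log_pow] at h2
    push_cast at h2
    have h4 := mul_le_mul_of_nonneg_left h3 (show (0 : ℝ) ≤ 2 ^ j by positivity)
    rw [pow_succ]
    linarith
  have e1 : Real.logb 2 (n.choose k : ℝ) / ε ^ 2 ≤ 115200 * q := by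
    rw [div_le_iff₀ hε2]
    linarith
  have e2 : (2 : ℝ) ^ k / ε ^ 2 ≤ 576000 * q := by
    rw [div_le_iff₀ hε2]
    linarith
  linarith
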